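/- **Theorem.** Let $G=(V,E)$ be a finite simple connected graph with $n\ge 2$ vertices $v_1,\dots,v_n$ and $m$ edges, let $d_i$ be the degree of $v_i$, let $A$ be the adjacency matrix and $D=\mathrm{diag}(d_1,\dots,d_n)$, and let $\mathcal L=I-D^{-1/2}AD^{-1/2}$ be the normalized Laplacian. For a real square matrix $B$ put $|B|=(BB^{*})^{1/2}$ (positive semidefinite square root). The normalized Laplacian energy of the vertex $v_i$ is $\mathcal{LE}(v_i)=|\mathcal L-I|_{ii}$, and that of the graph is $\mathcal{LE}(G)=\mathrm{tr}\,|\mathcal L-I|$. For $U\subseteq V$ let $\mathrm{vol}(U)=\sum_{v_i\in U}d_i$, and for disjoint $U,W\subseteq V$ let $E(U,W)$ be the set of edges with one endpoint in $U$ and the other in $W$. Let $$h(G)=\min_{\emptyset\ne U\subsetneq V}\frac{|E(U,V\setminus U)|}{\min\{\mathrm{vol}(U),\mathrm{vol}(V\setminus U)\}}$$ be the Cheeger constant and $$\bar h(G)=\max_{V_1,V_2}\frac{2|E(V_1,V_2)|}{\mathrm{vol}(V_1)+\mathrm{vol}(V_2)}$$ the dual Cheeger constant, the maximum being over all pairs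 of disjoint nonempty sets $V_1,V_2\subseteq V$ (where $V\setminus(V_1\cup V_2)$ may be empty). Put $$\alpha=\max\left\{\sqrt{1-h(G)^2},\ \sqrt{1-(1-\bar h(G))^2}\right\}.$$ Then, for every $1\le i\le n$, $$\mathcal{LE}(v_i)\le \frac{d_i}{2m}+\alpha\left(1-\frac{d_i}{2m}\right),$$ and $$\mathcal{LE}(G)\le 1+\alpha(n-1).$$ -/

import Mathlib

open scoped MatrixOrder

namespace VertexEnergy

/-- The absolute value `|B| = (B B^*)^{1/2}` of a real square matrix, with the positive
semidefinite square root. -/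
noncomputable def matrixAbs {V : Type*} [Fintype V] [DecidableEq V] (B : Matrix V V ℝ) :
    Matrix V V ℝ :=
  CFC.sqrt (B * B.conjTranspose)

theorem matrixAbs_posSemidef {V : Type*} [Fintype V] [DecidableEq V] (B : Matrix V V ℝ) :
    (matrixAbs B).PosSemidef :=
  Matrix.nonneg_iff_posSemidef.mp (CFC.sqrt_nonneg _)

theorem matrixAbs_mul_self {V : Type*} [Fintype V] [DecidableEq V] (B : Matrix V V ℝ) :
    matrixAbs B * matrixAbs B = B * B.conjTranspose :=
  CFC.sqrt_mul_sqrt_self _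
    (Matrix.nonneg_iff_posSemidef.mpr (Matrix.posSemidef_self_mul_conjTranspose B))

/-- The normalized Laplacian `I - D^{-1/2} A D^{-1/2}`. -/
noncomputable def normLaplacian {V : Type*} [Fintype V] [DecidableEq V]
    (G : SimpleGraph V) [DecidableRel G.Adj] : Matrix V V ℝ :=
  1 - Matrix.diagonal (fun v => (Real.sqrt (G.degree v))⁻¹) * G.adjMatrix ℝ *
    Matrix.diagonal (fun v => (Real.sqrt (G.degree v))⁻¹)

/-- The normalized Laplacian energy of a vertex, `|𝓛 - I|_{vv}`. -/
noncomputable def vertexNormEnergy {V : Type*} [Fintype V] [DecidableEq V]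
    (G : SimpleGraph V) [DecidableRel G.Adj] (v : V) : ℝ :=
  matrixAbs (normLaplacian G - 1) v v

/-- The normalized Laplacian energy of a graph, `tr |𝓛 - I|`. -/
noncomputable def graphNormEnergy {V : Type*} [Fintype V] [DecidableEq V]
    (G : SimpleGraph V) [DecidableRel G.Adj] : ℝ :=
  (matrixAbs (normLaplacian G - 1)).trace

/-- `vol(U)`, the sum of the degrees of the vertices in `U`. -/
def vol {V : Type*} [Fintype V] (G : SimpleGraph V) [DecidableRel G.Adj] (U : Finset V) : ℕ :=
  ∑ v ∈ U, G.degree v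

/-- `E(U, W)`, the set of edges with one endpoint in `U` and the other in `W`. -/
def edgesBetween {V : Type*} [Fintype V] [DecidableEq V] (G : SimpleGraph V)
    [DecidableRel G.Adj] (U W : Finset V) : Finset (Sym2 V) :=
  G.edgeFinset.filter (fun e => ∃ u ∈ U, ∃ w ∈ W, e = s(u, w))

/-- The values `|E(U, V∖U)| / min (vol U) (vol (V∖U))` over all nonempty proper `U ⊂ V`. -/
def cheegerRatios {V : Type*} [Fintype V] [DecidableEq V] (G : SimpleGraph V)
    [DecidableRel G.Adj] : Set ℝ :=
  {r | ∃ U : Finset V, U.Nonempty ∧ Uᶜ.Nonempty ∧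
    r = ((edgesBetween G U Uᶜ).card : ℝ) / min (vol G U : ℝ) (vol G Uᶜ : ℝ)}

/-- The Cheeger constant `h(G)`. -/
noncomputable def cheegerConst {V : Type*} [Fintype V] [DecidableEq V] (G : SimpleGraph V)
    [DecidableRel G.Adj] : ℝ :=
  sInf (cheegerRatios G)

/-- The values `2 |E(V₁, V₂)| / (vol V₁ + vol V₂)` over all disjoint nonempty `V₁, V₂ ⊆ V`
(the third part `V ∖ (V₁ ∪ V₂)` may be empty). -/
def dualCheegerRatios {V : Type*} [Fintype V] [DecidableEq V] (G : SimpleGraph V)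
    [DecidableRel G.Adj] : Set ℝ :=
  {r | ∃ V₁ V₂ : Finset V, V₁.Nonempty ∧ V₂.Nonempty ∧ Disjoint V₁ V₂ ∧
    r = 2 * ((edgesBetween G V₁ V₂).card : ℝ) / ((vol G V₁ : ℝ) + (vol G V₂ : ℝ))}

/-- The dual Cheeger constant `h̄(G)`. -/
noncomputable def dualCheegerConst {V : Type*} [Fintype V] [DecidableEq V] (G : SimpleGraph V)
    [DecidableRel G.Adj] : ℝ :=
  sSup (dualCheegerRatios G)

/-- On at least two vertices, the infimum defining `h(G)` is a minimum. -/
theorem cheegerConst_isLeast {V : Type*} [Fintype V] [DecidableEq V] [Nontrivial V]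
    (G : SimpleGraph V) [DecidableRel G.Adj] : IsLeast (cheegerRatios G) (cheegerConst G) := by
  have hfin : (cheegerRatios G).Finite := by
    refine (Set.finite_range (fun U : Finset V =>
      ((edgesBetween G U Uᶜ).card : ℝ) / min (vol G U : ℝ) (vol G Uᶜ : ℝ))).subset ?_
    rintro r ⟨U, -, -, rfl⟩
    exact ⟨U, rfl⟩
  obtain ⟨a, b, hab⟩ := exists_pair_ne V
  have hne : (cheegerRatios G).Nonempty :=
    ⟨_, {a}, ⟨a, by simp⟩, ⟨b, by simpa using hab.symm⟩, rfl⟩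
  exact ⟨hne.csInf_mem hfin, fun r hr => csInf_le hfin.bddBelow hr⟩

/-- On at least two vertices, the supremum defining `h̄(G)` is a maximum. -/
theorem dualCheegerConst_isGreatest {V : Type*} [Fintype V] [DecidableEq V] [Nontrivial V]
    (G : SimpleGraph V) [DecidableRel G.Adj] :
    IsGreatest (dualCheegerRatios G) (dualCheegerConst G) := by
  have hfin : (dualCheegerRatios G).Finite := by
    refine (Set.finite_range (fun P : Finset V × Finset V =>
      2 * ((edgesBetween G P.1 P.2).card : ℝ) / ((vol G P.1 : ℝ) + (vol G P.2 : ℝ)))).subset ?_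
    rintro r ⟨V₁, V₂, -, -, -, rfl⟩
    exact ⟨(V₁, V₂), rfl⟩
  obtain ⟨a, b, hab⟩ := exists_pair_ne V
  have hne : (dualCheegerRatios G).Nonempty :=
    ⟨_, {a}, {b}, ⟨a, by simp⟩, ⟨b, by simp⟩, by simpa using hab, rfl⟩
  exact ⟨hne.csSup_mem hfin, fun r hr => le_csSup hfin.bddAbove hr⟩

end VertexEnergy

/-! Put M = 1 - 𝓛 = D^{-1/2} A D^{-1/2}, so |M| = |𝓛 - I|. M fixes the vector D^{1/2}1; the
projection P onto its line has diagonal entries d_i/2m. Cheeger's inequality bounds the rest of the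
spectrum above by √(1-h²), and its dual bounds it below by -√(1-(1-h̄)²), so -α ≤ M - P ≤ α. Since
MP = PM = P, |M| = P + |M - P| ≤ P + α(1 - P). Diagonal entries give the vertex bound; summing them
gives the graph bound.

Both Cheeger bounds rest on `sum_mul_mul_le_sqrt`, a Dirichlet version obtained from the co-area
inequality for g² and Cauchy–Schwarz. `cheeger_inequality` applies it to the two parts of f on
either side of a median; `dual_cheeger_inequality` applies it to |f| on an auxiliary graph that
keeps only the weights across which f changes sign. -/

namespace VertexEnergy

/-! ### Cheeger inequalities for weighted graphs -/

section Weights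

variable {V : Type*} [Fintype V]

/-- Discrete co-area inequality: an isoperimetric inequality for all subsets of `U` yields an
`ℓ¹`-Sobolev inequality for the nonnegative functions supported in `U`. -/
theorem coarea_inequality [DecidableEq V] {a : V → V → ℝ} (ha : ∀ u v, a u v = a v u) {h : ℝ} {U : Finset V}
    (hcut : ∀ S ⊆ U, h * ∑ u ∈ S, ∑ v, a u v ≤ ∑ u ∈ S, ∑ v ∈ Sᶜ, a u v) (φ : V → ℝ)
    (hφ : ∀ v, 0 ≤ φ v) (hU : ∀ v, φ v ≠ 0 → v ∈ U) :
    2 * h * ∑ u, ∑ v, a u v * φ u ≤ ∑ u, ∑ v, a u v * |φ u - φ v| := by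
  -- Induction on the size of the support S: peel off the bottom layer c·χ of φ, where c is the
  -- least value on S. The remainder ψ vanishes at a minimizer, so its support is smaller.
  induction hk : (Finset.univ.filter fun v => φ v ≠ 0).card using Nat.strong_induction_on
    generalizing φ with
  | _ k ih =>
  set S := Finset.univ.filter fun v => φ v ≠ 0 with hS
  rcases S.eq_empty_or_nonempty with hem | hne
  · have h0 : ∀ v, φ v = 0 := by
      intro v
      by_contra hv
      have : v ∈ S := by simp [hS, hv]
      simp [hem] at this
    simp [h0]
  · obtain ⟨w, hw, hmin⟩ := S.exists_min_image φ hne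
    have hw0 : φ w ≠ 0 := by simpa [hS] using hw
    set c := φ w with hc
    have hout : ∀ v, v ∉ S → φ v = 0 := by
      intro v hv
      simpa [hS] using hv
    let ψ : V → ℝ := fun v => if v ∈ S then φ v - c else 0
    have hψ : ∀ v, 0 ≤ ψ v := by
      intro v
      by_cases hv : v ∈ S
      · simpa [ψ, hv] using hmin v hv
      · simp [ψ, hv]
    have hψS : ∀ v, ψ v ≠ 0 → v ∈ S := by
      intro v hv
      by_contra h'
      simp [ψ, h'] at hv
    have hSU : S ⊆ U := fun v hv => hU v (by simpa [hS] using hv)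
    have hlt : (Finset.univ.filter fun v => ψ v ≠ 0).card < k := by
      rw [← hk]
      refine Finset.card_lt_card (Finset.ssubset_iff_of_subset ?_ |>.2 ⟨w, hw, ?_⟩)
      · intro v hv
        exact hψS v (by simpa using hv)
      · simp [ψ, hw, ← hc]
    have key := ih _ hlt ψ hψ (fun v hv => hSU (hψS v hv)) rfl
    have hcS := hcut S hSU
    have hc0 : 0 ≤ c := hφ w
    let χ : V → ℝ := fun v => if v ∈ S then 1 else 0
    have e1 : ∀ u, φ u = ψ u + c * χ u := by
      intro u
      by_cases hu : u ∈ S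
      · simp [ψ, χ, hu]
      · simp [ψ, χ, hu, hout u hu]
    -- No cancellation occurs: ψ ≥ 0 is supported in S, so ψ and χ never vary in opposite
    -- directions.
    have e2 : ∀ u v, |φ u - φ v| = |ψ u - ψ v| + c * |χ u - χ v| := by
      intro u v
      by_cases hu : u ∈ S <;> by_cases hv : v ∈ S
      · simp [ψ, χ, hu, hv]
      · have h1 := hmin u hu
        simp [ψ, χ, hu, hv, hout v hv, abs_of_nonneg (hφ u), abs_of_nonneg (sub_nonneg.2 h1)]
      · have h1 := hmin v hv
        simp [ψ, χ, hu, hv, hout u hu, abs_of_nonneg (hφ v)]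
        rw [abs_sub_comm, abs_of_nonneg (sub_nonneg.2 h1)]; ring
      · simp [ψ, χ, hu, hv, hout u hu, hout v hv]
    have e3 : ∑ u, ∑ v, a u v * χ u = ∑ u ∈ S, ∑ v, a u v := by
      simp [χ, Finset.sum_ite_mem]
    have e5 : ∑ u, ∑ v, a u v * (χ u * (1 - χ v)) = ∑ u ∈ S, ∑ v ∈ Sᶜ, a u v := by
      rw [← Finset.sum_subset (Finset.subset_univ S)]
      · refine Finset.sum_congr rfl fun u hu => ?_
        rw [← Finset.sum_subset (Finset.subset_univ Sᶜ)]
        · refine Finset.sum_congr rfl fun v hv => ?_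
          simp [χ, hu, Finset.mem_compl.1 hv]
        · intro v _ hv
          simp [χ, not_not.1 (mt Finset.mem_compl.2 hv)]
      · intro u _ hu
        simp [χ, hu]
    have e6 : ∑ u, ∑ v, a u v * (χ v * (1 - χ u)) = ∑ u ∈ S, ∑ v ∈ Sᶜ, a u v := by
      rw [← e5, Finset.sum_comm]
      simp only [ha]
    have e4 : ∑ u, ∑ v, a u v * |χ u - χ v| = 2 * ∑ u ∈ S, ∑ v ∈ Sᶜ, a u v := by
      rw [two_mul]
      nth_rewrite 1 [← e5]
      rw [← e6]
      simp only [← Finset.sum_add_distrib]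
      refine Finset.sum_congr rfl fun u _ => Finset.sum_congr rfl fun v _ => ?_
      by_cases hu : u ∈ S <;> by_cases hv : v ∈ S <;> simp [χ, hu, hv]
    have l : ∑ u, ∑ v, a u v * φ u =
        ∑ u, ∑ v, a u v * ψ u + c * ∑ u, ∑ v, a u v * χ u := by
      simp only [Finset.mul_sum, ← Finset.sum_add_distrib]
      refine Finset.sum_congr rfl fun u _ => Finset.sum_congr rfl fun v _ => ?_
      rw [e1]; ring
    have r : ∑ u, ∑ v, a u v * |φ u - φ v| =
        ∑ u, ∑ v, a u v * |ψ u - ψ v| + c * ∑ u, ∑ v, a u v * |χ u - χ v| := by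
      simp only [Finset.mul_sum, ← Finset.sum_add_distrib]
      refine Finset.sum_congr rfl fun u _ => Finset.sum_congr rfl fun v _ => ?_
      rw [e2]; ring
    rw [l, r, e3, e4]
    have := mul_le_mul_of_nonneg_left hcS hc0
    nlinarith

/-- Cheeger's inequality with Dirichlet boundary conditions outside `U`. -/
theorem sum_mul_mul_le_sqrt [DecidableEq V] {a : V → V → ℝ} (ha : ∀ u v, a u v = a v u)
    (ha0 : ∀ u v, 0 ≤ a u v) {h : ℝ} (hh : 0 ≤ h) {U : Finset V}
    (hcut : ∀ S ⊆ U, h * ∑ u ∈ S, ∑ v, a u v ≤ ∑ u ∈ S, ∑ v ∈ Sᶜ, a u v) (g : V → ℝ)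
    (hU : ∀ v, g v ≠ 0 → v ∈ U) :
    ∑ u, ∑ v, a u v * (g u * g v) ≤ √(1 - h ^ 2) * ∑ u, ∑ v, a u v * g u ^ 2 := by
  have hco := coarea_inequality ha hcut (fun v => g v ^ 2) (fun v => sq_nonneg _)
    (fun v hv => hU v fun h0 => hv (by simp [h0]))
  have hcs : (∑ u, ∑ v, a u v * |g u ^ 2 - g v ^ 2|) ^ 2 ≤
      (∑ u, ∑ v, a u v * (g u - g v) ^ 2) * ∑ u, ∑ v, a u v * (g u + g v) ^ 2 := by
    simp only [← Fintype.sum_prod_type']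
    refine Finset.sum_sq_le_sum_mul_sum_of_sq_le_mul _ (fun p _ => ?_) (fun p _ => ?_)
      (fun p _ => ?_)
    · exact mul_nonneg (ha0 _ _) (sq_nonneg _)
    · exact mul_nonneg (ha0 _ _) (sq_nonneg _)
    · rw [mul_pow, sq_abs]; exact le_of_eq (by ring)
  set T := ∑ u, ∑ v, a u v * g u ^ 2 with hT
  set I := ∑ u, ∑ v, a u v * (g u * g v) with hI
  have hT' : ∑ u, ∑ v, a u v * g v ^ 2 = T := by
    rw [hT, Finset.sum_comm]
    simp only [ha]
  have hminus : ∑ u, ∑ v, a u v * (g u - g v) ^ 2 = T + T - 2 * I := by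
    nth_rewrite 2 [← hT']
    simp only [hT, hI, Finset.mul_sum, ← Finset.sum_add_distrib, ← Finset.sum_sub_distrib]
    exact Finset.sum_congr rfl fun u _ => Finset.sum_congr rfl fun v _ => by ring
  have hplus : ∑ u, ∑ v, a u v * (g u + g v) ^ 2 = T + T + 2 * I := by
    nth_rewrite 2 [← hT']
    simp only [hT, hI, Finset.mul_sum, ← Finset.sum_add_distrib]
    exact Finset.sum_congr rfl fun u _ => Finset.sum_congr rfl fun v _ => by ring
  have hT0 : 0 ≤ T :=
    Finset.sum_nonneg fun u _ => Finset.sum_nonneg fun v _ => mul_nonneg (ha0 _ _) (sq_nonneg _)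
  rw [hminus, hplus] at hcs
  -- The right side is 4(T² - I²). Keeping both factors, rather than bounding T + I by 2T, gives the
  -- sharp √(1 - h²).
  have hsq : (2 * h * T) ^ 2 ≤ (T + T - 2 * I) * (T + T + 2 * I) :=
    (pow_le_pow_left₀ (by positivity) hco 2).trans hcs
  have hI2 : I ^ 2 ≤ (1 - h ^ 2) * T ^ 2 := by nlinarith
  have := Real.abs_le_sqrt hI2
  rw [Real.sqrt_mul' _ (sq_nonneg T), Real.sqrt_sq hT0] at this
  exact (le_abs_self I).trans this

/-- A real function on a finite nonempty weighted set has a weighted median. -/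
theorem exists_weighted_median [Nonempty V] {d : V → ℝ} (hd : ∀ v, 0 ≤ d v) (f : V → ℝ) :
    ∃ c, 2 * ∑ v with c < f v, d v ≤ ∑ v, d v ∧ 2 * ∑ v with f v < c, d v ≤ ∑ v, d v := by
  have hD : 0 ≤ ∑ v, d v := Finset.sum_nonneg fun v _ => hd v
  let C : Finset V := Finset.univ.filter fun w => 2 * ∑ v with f w < f v, d v ≤ ∑ v, d v
  have hC : C.Nonempty := by
    obtain ⟨w, -, hw⟩ := Finset.univ.exists_max_image f Finset.univ_nonempty
    refine ⟨w, ?_⟩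
    have : (Finset.univ.filter fun v => f w < f v) = ∅ := by
      ext v; simpa using hw v (Finset.mem_univ v)
    simpa [C, this] using hD
  -- The least value whose upper tail is at most half. The next smaller value, if any, has upper
  -- tail above half, and the complement of that tail is the lower tail of w.
  obtain ⟨w, hw, hmin⟩ := C.exists_min_image f hC
  refine ⟨f w, by simpa [C] using hw, ?_⟩
  rcases (Finset.univ.filter fun v => f v < f w).eq_empty_or_nonempty with hem | hne
  · simpa [hem] using hD
  · obtain ⟨x, hx, hmax⟩ := Finset.exists_max_image _ f hne
    have hxw : f x < f w := by simpa using hx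
    have hxC : x ∉ C := fun h' => absurd (hmin x h') (not_le.2 hxw)
    have h1 : ∑ v, d v < 2 * ∑ v with f x < f v, d v := by simpa [C] using hxC
    have h2 : (Finset.univ.filter fun v => f v < f w) =
        Finset.univ.filter fun v => ¬ f x < f v := by
      ext v
      simp only [Finset.mem_filter, Finset.mem_univ, true_and, not_lt]
      exact ⟨fun hv => hmax v (by simpa using hv), fun hv => hv.trans_lt hxw⟩
    have h3 := Finset.sum_filter_add_sum_filter_not Finset.univ (fun v => f x < f v) d
    rw [h2]
    linarith

/-- Cheeger's inequality for a weighted graph, as a bound for the quadratic form of the weights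
on the functions orthogonal to the constants. -/
theorem cheeger_inequality [DecidableEq V] {a : V → V → ℝ} (ha : ∀ u v, a u v = a v u)
    (ha0 : ∀ u v, 0 ≤ a u v) {h : ℝ} (hh : 0 ≤ h)
    (hcut : ∀ S : Finset V, 2 * ∑ u ∈ S, ∑ v, a u v ≤ ∑ u, ∑ v, a u v →
      h * ∑ u ∈ S, ∑ v, a u v ≤ ∑ u ∈ S, ∑ v ∈ Sᶜ, a u v) (f : V → ℝ)
    (hf : ∑ u, ∑ v, a u v * f u = 0) :
    ∑ u, ∑ v, a u v * (f u * f v) ≤ √(1 - h ^ 2) * ∑ u, ∑ v, a u v * f u ^ 2 := by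
  cases isEmpty_or_nonempty V
  · simp
  have hd : ∀ u, 0 ≤ ∑ v, a u v := fun u => Finset.sum_nonneg fun v _ => ha0 u v
  obtain ⟨c, hc1, hc2⟩ := exists_weighted_median hd f
  have mono : ∀ U : Finset V, 2 * ∑ u ∈ U, ∑ v, a u v ≤ ∑ u, ∑ v, a u v → ∀ S ⊆ U,
      h * ∑ u ∈ S, ∑ v, a u v ≤ ∑ u ∈ S, ∑ v ∈ Sᶜ, a u v := by
    intro U hU S hS
    refine hcut S (le_trans ?_ hU)
    have := Finset.sum_le_sum_of_subset_of_nonneg hS (fun u _ _ => hd u)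
    linarith
  let p : V → ℝ := fun v => max (f v - c) 0
  let q : V → ℝ := fun v => max (c - f v) 0
  have hp0 : ∀ v, 0 ≤ p v := fun v => le_max_right _ _
  have hq0 : ∀ v, 0 ≤ q v := fun v => le_max_right _ _
  have hp := sum_mul_mul_le_sqrt ha ha0 hh (mono _ hc1) p (by
    intro v hv
    by_contra h'
    refine hv (max_eq_right ?_)
    simp at h'
    linarith)
  have hq := sum_mul_mul_le_sqrt ha ha0 hh (mono _ hc2) q (by
    intro v hv
    by_contra h'
    refine hv (max_eq_right ?_)
    simp at h'
    linarith)
  have hpq : ∀ v, f v - c = p v - q v := by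
    intro v
    rcases le_total (f v) c with h' | h'
    · simp [p, q, max_eq_right (sub_nonpos.2 h'), max_eq_left (sub_nonneg.2 h')]
    · simp [p, q, max_eq_right (sub_nonpos.2 h'), max_eq_left (sub_nonneg.2 h')]
  have hpq' : ∀ v, (f v - c) ^ 2 = p v ^ 2 + q v ^ 2 := by
    intro v
    rcases le_total (f v) c with h' | h'
    · simp [p, q, max_eq_right (sub_nonpos.2 h'), max_eq_left (sub_nonneg.2 h')]; ring
    · simp [p, q, max_eq_right (sub_nonpos.2 h'), max_eq_left (sub_nonneg.2 h')]
  have hf' : ∑ u, ∑ v, a u v * f v = 0 := by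
    rw [← hf, Finset.sum_comm]
    simp only [ha]
  -- Because f is orthogonal to the constants, shifting by c adds the same c²·vol to the form and to
  -- the square norm; √(1 - h²) ≤ 1 lets this term be dropped at the end.
  have h1 : ∑ u, ∑ v, a u v * (f u * f v) + c ^ 2 * ∑ u, ∑ v, a u v =
      ∑ u, ∑ v, a u v * ((f u - c) * (f v - c)) := by
    have : ∑ u, ∑ v, a u v * ((f u - c) * (f v - c)) = ∑ u, ∑ v, a u v * (f u * f v)
        + c ^ 2 * ∑ u, ∑ v, a u v - c * ∑ u, ∑ v, a u v * f u - c * ∑ u, ∑ v, a u v * f v := by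
      simp only [Finset.mul_sum, ← Finset.sum_add_distrib, ← Finset.sum_sub_distrib]
      exact Finset.sum_congr rfl fun u _ => Finset.sum_congr rfl fun v _ => by ring
    rw [this, hf, hf']; ring
  have h2 : ∑ u, ∑ v, a u v * f u ^ 2 + c ^ 2 * ∑ u, ∑ v, a u v =
      ∑ u, ∑ v, a u v * p u ^ 2 + ∑ u, ∑ v, a u v * q u ^ 2 := by
    have : ∑ u, ∑ v, a u v * p u ^ 2 + ∑ u, ∑ v, a u v * q u ^ 2 =
        ∑ u, ∑ v, a u v * f u ^ 2 + c ^ 2 * ∑ u, ∑ v, a u v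
          - 2 * c * ∑ u, ∑ v, a u v * f u := by
      simp only [Finset.mul_sum, ← Finset.sum_add_distrib, ← Finset.sum_sub_distrib]
      refine Finset.sum_congr rfl fun u _ => Finset.sum_congr rfl fun v _ => ?_
      rw [← mul_add, ← hpq' u]; ring
    rw [this, hf]; ring
  have h3 : ∑ u, ∑ v, a u v * ((f u - c) * (f v - c)) ≤
      ∑ u, ∑ v, a u v * (p u * p v) + ∑ u, ∑ v, a u v * (q u * q v) := by
    simp only [← Finset.sum_add_distrib]
    refine Finset.sum_le_sum fun u _ => Finset.sum_le_sum fun v _ => ?_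
    rw [← mul_add, hpq u, hpq v]
    refine mul_le_mul_of_nonneg_left ?_ (ha0 u v)
    have := mul_nonneg (hp0 u) (hq0 v)
    have := mul_nonneg (hq0 u) (hp0 v)
    linarith
  have hκ : √(1 - h ^ 2) ≤ 1 := Real.sqrt_le_one.2 (by nlinarith)
  have hvol : 0 ≤ c ^ 2 * ∑ u, ∑ v, a u v :=
    mul_nonneg (sq_nonneg _) (Finset.sum_nonneg fun u _ => hd u)
  have h4 := mul_le_mul_of_nonneg_right hκ hvol
  have h5 : ∑ u, ∑ v, a u v * (f u * f v) + c ^ 2 * ∑ u, ∑ v, a u v ≤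
      √(1 - h ^ 2) * (∑ u, ∑ v, a u v * f u ^ 2 + c ^ 2 * ∑ u, ∑ v, a u v) := by
    rw [h1, h2, mul_add]
    linarith
  rw [mul_add] at h5
  linarith

/-- The dual Cheeger inequality for a weighted graph. -/
theorem dual_cheeger_inequality [DecidableEq V] {a : V → V → ℝ} (ha : ∀ u v, a u v = a v u)
    (ha0 : ∀ u v, 0 ≤ a u v) {k : ℝ} (hk : k ≤ 1)
    (hcut : ∀ S T : Finset V, Disjoint S T → 2 * ∑ u ∈ S, ∑ v ∈ T, a u v ≤
      k * (∑ u ∈ S, ∑ v, a u v + ∑ u ∈ T, ∑ v, a u v)) (f : V → ℝ) :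
    -∑ u, ∑ v, a u v * (f u * f v) ≤ √(1 - (1 - k) ^ 2) * ∑ u, ∑ v, a u v * f u ^ 2 := by
  let a₁ : V → V → ℝ := fun u v => if f u * f v < 0 then a u v else 0
  have ha₁ : ∀ u v, a₁ u v = a₁ v u := fun u v => by simp only [a₁, mul_comm (f u), ha u]
  have ha₁0 : ∀ u v, 0 ≤ a₁ u v := fun u v => by
    simp only [a₁]; split_ifs; exacts [ha0 u v, le_rfl]
  have ha₁a : ∀ u v, a₁ u v ≤ a u v := fun u v => by
    simp only [a₁]; split_ifs; exacts [le_rfl, ha0 u v]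
  let b : V → ℝ := fun u => ∑ v, (a u v - a₁ u v)
  have hb : ∀ u, 0 ≤ b u := fun u => Finset.sum_nonneg fun v _ => sub_nonneg.2 (ha₁a u v)
  -- a ghost vertex absorbs the weight of the pairs on which `f` does not change sign
  let a' : Option V → Option V → ℝ := fun x y =>
    x.elim (y.elim 0 b) fun u => y.elim (b u) fun v => a₁ u v
  have hsum : ∀ u, ∑ y, a' (some u) y = ∑ v, a u v := by
    intro u
    rw [Fintype.sum_option]
    simp [a', b]
  -- The ghost vertex has value 0, so it lies outside U: it preserves the degrees and only adds to
  -- the boundary.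
  let U : Finset (Option V) := Finset.univ.filter fun x => x.elim 0 f ≠ 0
  have hmain := sum_mul_mul_le_sqrt (a := a') (h := 1 - k) (U := U)
    (by rintro (_ | u) (_ | v) <;> simp [a', ha₁])
    (by rintro (_ | u) (_ | v) <;> simp [a', ha₁0, hb]) (sub_nonneg.2 hk)
    (by
      intro S hS
      have hnone : none ∉ S := fun h' => by simpa [U] using hS h'
      let T : Finset V := Finset.univ.filter fun v => some v ∈ S
      have hST : S = T.map Function.Embedding.some := by
        ext (_ | v)
        · simp [hnone]
        · simp [T]
      have hT0 : ∀ v ∈ T, f v ≠ 0 := by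
        intro v hv
        have : some v ∈ U := hS (by simpa [T] using hv)
        simpa [U] using this
      have hcompl : ∀ u, ∑ y ∈ Sᶜ, a' (some u) y = ∑ v, a u v - ∑ v ∈ T, a₁ u v := by
        intro u
        have := Finset.sum_add_sum_compl S (a' (some u))
        rw [hsum] at this
        have h' : ∑ y ∈ S, a' (some u) y = ∑ v ∈ T, a₁ u v := by
          rw [hST, Finset.sum_map]; rfl
        linarith
      have l : ∑ x ∈ S, ∑ y, a' x y = ∑ u ∈ T, ∑ v, a u v := by
        rw [hST, Finset.sum_map]
        exact Finset.sum_congr rfl fun u _ => hsum u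
      have r : ∑ x ∈ S, ∑ y ∈ Sᶜ, a' x y =
          ∑ u ∈ T, ∑ v, a u v - ∑ u ∈ T, ∑ v ∈ T, a₁ u v := by
        nth_rewrite 1 [hST]
        rw [Finset.sum_map, ← Finset.sum_sub_distrib]
        exact Finset.sum_congr rfl fun u _ => hcompl u
      let T₁ := T.filter fun v => 0 < f v
      let T₂ := T.filter fun v => ¬ 0 < f v
      have hdis : Disjoint T₁ T₂ := Finset.disjoint_filter_filter_not _ _ _
      have hsplit : ∀ F : V → ℝ, ∑ v ∈ T, F v = ∑ v ∈ T₁, F v + ∑ v ∈ T₂, F v := fun F =>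
        (Finset.sum_filter_add_sum_filter_not T _ F).symm
      have hneg : ∀ v ∈ T₂, f v < 0 := by
        intro v hv
        obtain ⟨h1, h2⟩ := Finset.mem_filter.1 hv
        exact lt_of_le_of_ne (not_lt.1 h2) (hT0 v h1)
      have hpos : ∀ v ∈ T₁, 0 < f v := fun v hv => (Finset.mem_filter.1 hv).2
      have h11 : ∑ u ∈ T₁, ∑ v ∈ T₁, a₁ u v = 0 :=
        Finset.sum_eq_zero fun u hu => Finset.sum_eq_zero fun v hv =>
          if_neg (not_lt.2 (mul_pos (hpos u hu) (hpos v hv)).le)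
      have h22 : ∑ u ∈ T₂, ∑ v ∈ T₂, a₁ u v = 0 :=
        Finset.sum_eq_zero fun u hu => Finset.sum_eq_zero fun v hv =>
          if_neg (not_lt.2 (mul_pos_of_neg_of_neg (hneg u hu) (hneg v hv)).le)
      have h12 : ∑ u ∈ T₁, ∑ v ∈ T₂, a₁ u v ≤ ∑ u ∈ T₁, ∑ v ∈ T₂, a u v :=
        Finset.sum_le_sum fun u _ => Finset.sum_le_sum fun v _ => ha₁a u v
      have h21 : ∑ u ∈ T₂, ∑ v ∈ T₁, a₁ u v = ∑ u ∈ T₁, ∑ v ∈ T₂, a₁ u v := by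
        rw [Finset.sum_comm]
        simp only [ha₁]
      -- `a₁` vanishes within each sign class, so only the weight between T₁ and T₂ is lost from the
      -- boundary of S; `hcut` bounds it by k·vol, leaving at least (1 - k)·vol.
      have hTT : ∑ u ∈ T, ∑ v ∈ T, a₁ u v ≤ 2 * ∑ u ∈ T₁, ∑ v ∈ T₂, a u v := by
        simp only [hsplit, Finset.sum_add_distrib]
        linarith
      have := hcut T₁ T₂ hdis
      rw [← hsplit] at this
      rw [l, r, sub_mul, one_mul]
      linarith)
    (fun x => |x.elim 0 f|) (fun x hx => by simpa [U] using hx)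
  have e1 : ∑ x, ∑ y, a' x y * (|x.elim 0 f| * |y.elim 0 f|) =
      ∑ u, ∑ v, a₁ u v * (|f u| * |f v|) := by
    simp [Fintype.sum_option, a']
  have e2 : ∑ x, ∑ y, a' x y * |x.elim 0 f| ^ 2 = ∑ u, ∑ v, a u v * f u ^ 2 := by
    rw [Fintype.sum_option]
    simp only [← Finset.sum_mul, hsum]
    simp
  rw [e1, e2] at hmain
  refine le_trans ?_ hmain
  simp only [← Finset.sum_neg_distrib]
  refine Finset.sum_le_sum fun u _ => Finset.sum_le_sum fun v _ => ?_
  rw [← abs_mul]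
  simp only [a₁]
  split_ifs with h'
  · rw [abs_of_neg h']; linarith
  · have := mul_nonneg (ha0 u v) (not_lt.1 h')
    linarith

end Weights

/-! ### Absolute value of a symmetric matrix with a projection split off -/

section Matrices

variable {V : Type*} [Fintype V] [DecidableEq V]

theorem matrixAbs_neg (B : Matrix V V ℝ) : matrixAbs (-B) = matrixAbs B := by
  simp [matrixAbs]

/-- If `P` is an orthogonal projection onto fixed vectors of the symmetric matrix `M`, and
`-β ≤ M - P ≤ β`, then `|M| ≤ P + β (1 - P)` on the diagonal. -/
theorem matrixAbs_diag_le {M P : Matrix V V ℝ} (hM : M.conjTranspose = M)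
    (hP : P.conjTranspose = P) (hPP : P * P = P) (hMP : M * P = P) {β : ℝ} (hβ : 0 < β)
    (h1 : (β • 1 - (M - P)).PosSemidef) (h2 : (β • 1 + (M - P)).PosSemidef) (v : V) :
    matrixAbs M v v ≤ P v v + β * (1 - P v v) := by
  have hPM : P * M = P := by
    have := congrArg Matrix.conjTranspose hMP
    rwa [Matrix.conjTranspose_mul, hM, hP] at this
  set N := M - P with hN
  have hNH : N.conjTranspose = N := by rw [hN, Matrix.conjTranspose_sub, hM, hP]
  have hNP : N * P = 0 := by rw [hN, sub_mul, hMP, hPP, sub_self]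
  set K := matrixAbs N with hK
  have hKps : K.PosSemidef := matrixAbs_posSemidef N
  have hKH : K.conjTranspose = K := hKps.isHermitian
  have hKK : K * K = N * N := by rw [hK, matrixAbs_mul_self, hNH]
  -- (KP)ᵀ(KP) = P N² P = 0.
  have hKP : K * P = 0 := by
    rw [← Matrix.conjTranspose_mul_self_eq_zero, Matrix.conjTranspose_mul, hKH, hP,
      mul_assoc, ← mul_assoc K, hKK, mul_assoc, hNP, mul_zero, mul_zero]
  have hPK : P * K = 0 := by
    have := congrArg Matrix.conjTranspose hKP
    rwa [Matrix.conjTranspose_mul, hKH, hP, Matrix.conjTranspose_zero] at this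
  have hPps : P.PosSemidef := by
    have := Matrix.posSemidef_conjTranspose_mul_self P
    rwa [hP, hPP] at this
  have hNN : N * N = M * M - P := by
    rw [hN, sub_mul, mul_sub, mul_sub, hMP, hPM, hPP]; abel
  have habs : matrixAbs M = P + K := by
    refine CFC.sqrt_unique ?_ (Matrix.nonneg_iff_posSemidef.2 (hPps.add hKps))
    rw [hM, add_mul, mul_add, mul_add, hPP, hPK, hKP, hKK, hNN]; abel
  have hX : (β • 1 - N : Matrix V V ℝ).conjTranspose = β • 1 - N := h1.isHermitian
  have hY : (β • 1 + N : Matrix V V ℝ).conjTranspose = β • 1 + N := h2.isHermitian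
  -- With X = β - N and Y = β + N, which commute, XYX + YXY = XY(X + Y) = 2β(β² - N²).
  have hsq : ((2 * β) • (β ^ 2 • 1 - N * N : Matrix V V ℝ)).PosSemidef := by
    have hXYX := h2.conjTranspose_mul_mul_same (β • 1 - N)
    have hYXY := h1.conjTranspose_mul_mul_same (β • 1 + N)
    rw [hX] at hXYX
    rw [hY] at hYXY
    convert hXYX.add hYXY using 1
    simp only [sub_mul, mul_sub, add_mul, mul_add, smul_mul_assoc, mul_smul_comm, one_mul,
      mul_one, smul_sub, smul_add, smul_smul, mul_assoc]
    module
  have hsq' : (β ^ 2 • 1 - N * N : Matrix V V ℝ).PosSemidef := by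
    have := hsq.smul (a := (2 * β)⁻¹) (by positivity)
    rwa [smul_smul, inv_mul_cancel₀ (by positivity), one_smul] at this
  -- As K² = N², (K - β)² + (β² - N²) = 2β(β - K).
  have hKβ : (β • 1 - K : Matrix V V ℝ).PosSemidef := by
    have hS := Matrix.posSemidef_conjTranspose_mul_self (K - β • 1)
    rw [Matrix.conjTranspose_sub, hKH, Matrix.conjTranspose_smul, Matrix.conjTranspose_one,
      star_trivial] at hS
    have := (hS.add hsq').smul (a := (2 * β)⁻¹) (by positivity)
    convert this using 1
    have : (K - β • 1) * (K - β • 1) + (β ^ 2 • 1 - N * N) = (2 * β) • (β • 1 - K) := by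
      rw [← hKK]
      simp only [sub_mul, mul_sub, smul_mul_assoc, mul_smul_comm, one_mul,
        mul_one, smul_sub, smul_smul]
      module
    rw [this, smul_smul, inv_mul_cancel₀ (by positivity), one_smul]
  -- Compressing by 1 - P improves K ≤ β to K ≤ β(1 - P), since K already kills the range of P.
  have hR := (hKβ.conjTranspose_mul_mul_same (1 - P)).diag_nonneg (i := v)
  have hRe : (1 - P).conjTranspose * (β • 1 - K) * (1 - P) = β • (1 - P) - K := by
    rw [Matrix.conjTranspose_sub, Matrix.conjTranspose_one, hP]
    simp only [sub_mul, mul_sub, smul_mul_assoc, mul_smul_comm, one_mul, mul_one,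
      smul_sub, hPP, hKP, hPK, zero_mul]
    module
  rw [hRe] at hR
  simp only [Matrix.sub_apply, Matrix.smul_apply, Matrix.one_apply_eq, smul_eq_mul] at hR
  rw [habs, Matrix.add_apply]
  linarith

end Matrices

/-! ### Cheeger constants as cut inequalities for the adjacency matrix -/

section Graphs

variable {V : Type*} (G : SimpleGraph V) [DecidableRel G.Adj]

theorem sum_adjMatrix [Fintype V] (u : V) : ∑ v, G.adjMatrix ℝ u v = G.degree u := by
  simp [SimpleGraph.adjMatrix_apply, ← SimpleGraph.card_neighborFinset_eq_degree,
    SimpleGraph.neighborFinset_eq_filter]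

theorem adjMatrix_symm (u v : V) : G.adjMatrix ℝ u v = G.adjMatrix ℝ v u := by
  simp [SimpleGraph.adjMatrix_apply, G.adj_comm]

theorem adjMatrix_nonneg (u v : V) : 0 ≤ G.adjMatrix ℝ u v := by
  rw [SimpleGraph.adjMatrix_apply]; split_ifs <;> norm_num

theorem vol_eq_sum_adjMatrix [Fintype V] (S : Finset V) :
    (vol G S : ℝ) = ∑ u ∈ S, ∑ v, G.adjMatrix ℝ u v := by
  simp only [vol, Nat.cast_sum, sum_adjMatrix]

variable [Fintype V] [DecidableEq V]

theorem card_edgesBetween {S T : Finset V} (hST : Disjoint S T) :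
    ((edgesBetween G S T).card : ℝ) = ∑ u ∈ S, ∑ v ∈ T, G.adjMatrix ℝ u v := by
  have himg : edgesBetween G S T =
      ((S ×ˢ T).filter fun p => G.Adj p.1 p.2).image fun p => s(p.1, p.2) := by
    ext e
    simp only [edgesBetween, Finset.mem_filter, Finset.mem_image, Finset.mem_product,
      SimpleGraph.mem_edgeFinset, Prod.exists]
    constructor
    · rintro ⟨he, u, hu, w, hw, rfl⟩
      exact ⟨u, w, ⟨⟨hu, hw⟩, he⟩, rfl⟩
    · rintro ⟨u, w, ⟨⟨hu, hw⟩, he⟩, rfl⟩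
      exact ⟨he, u, hu, w, hw, rfl⟩
  have hinj : Set.InjOn (fun p : V × V => s(p.1, p.2))
      ((S ×ˢ T).filter fun p => G.Adj p.1 p.2 : Finset (V × V)) := by
    rintro ⟨u, w⟩ hp ⟨u', w'⟩ hq hpq
    simp only [Finset.coe_filter, Finset.mem_product, Set.mem_ofPred_eq] at hp hq
    rcases Sym2.eq_iff.1 hpq with ⟨rfl, rfl⟩ | ⟨rfl, rfl⟩
    · rfl
    -- A swapped pair would put one vertex in both S and T.
    · exact absurd hq.1.2 (Finset.disjoint_left.1 hST hp.1.1)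
  rw [himg, Finset.card_image_of_injOn hinj, Finset.card_filter, Finset.sum_product]
  simp [SimpleGraph.adjMatrix_apply]

theorem cheegerConst_nonneg : 0 ≤ cheegerConst G := by
  refine Real.sInf_nonneg ?_
  rintro r ⟨U, -, -, rfl⟩
  positivity

theorem cheegerConst_mul_vol_le [Nontrivial V] {S : Finset V} (hS : vol G S ≤ vol G Sᶜ) :
    cheegerConst G * vol G S ≤ (edgesBetween G S Sᶜ).card := by
  rcases Nat.eq_zero_or_pos (vol G S) with h0 | hpos
  · simp [h0]
  have hne : ∀ T : Finset V, 0 < vol G T → T.Nonempty := by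
    intro T hT
    rw [Finset.nonempty_iff_ne_empty]
    rintro rfl
    simp [vol] at hT
  have := (cheegerConst_isLeast G).2 ⟨S, hne _ hpos, hne _ (hpos.trans_le hS), rfl⟩
  rwa [min_eq_left (by exact_mod_cast hS), le_div_iff₀ (by exact_mod_cast hpos)] at this

theorem card_edgesBetween_le_vol {S T : Finset V} (hST : Disjoint S T) :
    ((edgesBetween G S T).card : ℝ) ≤ vol G S := by
  rw [card_edgesBetween G hST, vol_eq_sum_adjMatrix]
  exact Finset.sum_le_sum fun u _ => Finset.sum_le_sum_of_subset_of_nonneg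
    (Finset.subset_univ _) fun v _ _ => adjMatrix_nonneg G u v

theorem edgesBetween_comm (S T : Finset V) : edgesBetween G S T = edgesBetween G T S := by
  ext e
  simp only [edgesBetween, Finset.mem_filter]
  refine and_congr_right fun _ => ⟨?_, ?_⟩ <;>
  · rintro ⟨u, hu, w, hw, rfl⟩
    exact ⟨w, hw, u, hu, Sym2.eq_swap⟩

theorem dualCheegerConst_nonneg : 0 ≤ dualCheegerConst G := by
  refine Real.sSup_nonneg ?_
  rintro r ⟨S, T, -, -, -, rfl⟩
  positivity

theorem dualCheegerConst_le_one : dualCheegerConst G ≤ 1 := by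
  refine Real.sSup_le ?_ zero_le_one
  rintro r ⟨S, T, -, -, hST, rfl⟩
  refine div_le_one_of_le₀ ?_ (by positivity)
  have h1 := card_edgesBetween_le_vol G hST
  have h2 := card_edgesBetween_le_vol G hST.symm
  rw [edgesBetween_comm] at h2
  linarith

/-- Empty S or T must be allowed, since f may have a single sign in the dual inequality. At total
volume zero, where the ratio carries no information, the edge count is zero too. -/
theorem two_mul_card_edgesBetween_le [Nontrivial V] {S T : Finset V} (hST : Disjoint S T) :
    2 * ((edgesBetween G S T).card : ℝ) ≤ dualCheegerConst G * (vol G S + vol G T) := by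
  have hright : 0 ≤ dualCheegerConst G * (vol G S + vol G T) :=
    mul_nonneg (dualCheegerConst_nonneg G) (by positivity)
  rcases S.eq_empty_or_nonempty with rfl | hS
  · simpa [edgesBetween] using hright
  rcases T.eq_empty_or_nonempty with rfl | hT
  · simpa [edgesBetween] using hright
  have h1 := card_edgesBetween_le_vol G hST
  have h0 : (0 : ℝ) ≤ vol G S := by positivity
  have h0' : (0 : ℝ) ≤ vol G T := by positivity
  rcases (add_nonneg h0 h0').eq_or_lt with hz | hpos
  · rw [← hz, mul_zero]
    linarith
  · have := (dualCheegerConst_isGreatest G).2 ⟨S, T, hS, hT, hST, rfl⟩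
    rwa [div_le_iff₀ hpos] at this

/-- Cheeger's inequality in terms of the Cheeger constant of a graph. -/
theorem adjMatrix_form_le [Nontrivial V] {f : V → ℝ} (hf : ∑ u, (G.degree u : ℝ) * f u = 0) :
    ∑ u, ∑ v, G.adjMatrix ℝ u v * (f u * f v) ≤
      √(1 - cheegerConst G ^ 2) * ∑ u, G.degree u * f u ^ 2 := by
  have := cheeger_inequality (adjMatrix_symm G) (adjMatrix_nonneg G) (cheegerConst_nonneg G)
    (by
      intro S hS
      have htot := Finset.sum_add_sum_compl S fun u => ∑ v, G.adjMatrix ℝ u v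
      rw [← htot] at hS
      simp only [← vol_eq_sum_adjMatrix] at hS ⊢
      rw [← card_edgesBetween G disjoint_compl_right]
      refine cheegerConst_mul_vol_le G ?_
      have : (vol G S : ℝ) ≤ vol G Sᶜ := by linarith
      exact_mod_cast this) f
    (by simpa only [← Finset.sum_mul, sum_adjMatrix] using hf)
  simpa only [← Finset.sum_mul, sum_adjMatrix] using this

/-- The dual Cheeger inequality in terms of the dual Cheeger constant of a graph. -/
theorem neg_adjMatrix_form_le [Nontrivial V] (f : V → ℝ) :
    -∑ u, ∑ v, G.adjMatrix ℝ u v * (f u * f v) ≤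
      √(1 - (1 - dualCheegerConst G) ^ 2) * ∑ u, G.degree u * f u ^ 2 := by
  have := dual_cheeger_inequality (adjMatrix_symm G) (adjMatrix_nonneg G)
    (dualCheegerConst_le_one G)
    (by
      intro S T hST
      rw [← card_edgesBetween G hST, ← vol_eq_sum_adjMatrix, ← vol_eq_sum_adjMatrix]
      exact two_mul_card_edgesBetween_le G hST) f
  simpa only [← Finset.sum_mul, sum_adjMatrix] using this

end Graphs

/-! ### From quadratic forms to energies -/

section Energy

variable {V : Type*} [Fintype V] (G : SimpleGraph V) [DecidableRel G.Adj]

/-- The projection onto the line spanned by `D^{1/2} 1`. -/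
noncomputable def degreeProj : Matrix V V ℝ :=
  Matrix.of fun u v => √(G.degree u) * √(G.degree v) / ∑ w, (G.degree w : ℝ)

theorem degreeProj_apply_self (v : V) :
    degreeProj G v v = G.degree v / ∑ w, (G.degree w : ℝ) := by
  simp [degreeProj]

variable {G} in
theorem degreeProj_mul_self (hσ : 0 < ∑ w, (G.degree w : ℝ)) :
    degreeProj G * degreeProj G = degreeProj G := by
  ext u v
  simp only [Matrix.mul_apply, degreeProj, Matrix.of_apply]
  have : ∀ w, √(G.degree u : ℝ) * √(G.degree w) / (∑ w, (G.degree w : ℝ)) *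
      (√(G.degree w) * √(G.degree v) / ∑ w, (G.degree w : ℝ)) =
      (G.degree w : ℝ) * (√(G.degree u) * √(G.degree v) / (∑ w, (G.degree w : ℝ)) ^ 2) := by
    intro w
    nth_rewrite 3 [← Real.mul_self_sqrt (Nat.cast_nonneg (α := ℝ) (G.degree w))]
    ring
  rw [Finset.sum_congr rfl fun w _ => this w, ← Finset.sum_mul]
  field_simp

variable [DecidableEq V]

theorem one_sub_normLaplacian_apply (u v : V) :
    (1 - normLaplacian G) u v = G.adjMatrix ℝ u v / (√(G.degree u) * √(G.degree v)) := by
  rw [normLaplacian, sub_sub_cancel, Matrix.mul_diagonal, Matrix.diagonal_mul]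
  simp only [div_eq_mul_inv, mul_inv]
  ring

variable {G}

theorem one_sub_normLaplacian_mul_degreeProj (hd : ∀ v, 0 < (G.degree v : ℝ)) :
    (1 - normLaplacian G) * degreeProj G = degreeProj G := by
  ext u v
  simp only [Matrix.mul_apply, one_sub_normLaplacian_apply]
  simp only [degreeProj, Matrix.of_apply]
  have : ∀ w, G.adjMatrix ℝ u w / (√(G.degree u : ℝ) * √(G.degree w)) *
      (√(G.degree w) * √(G.degree v) / ∑ w, (G.degree w : ℝ)) =
      G.adjMatrix ℝ u w * ((√(G.degree u))⁻¹ * √(G.degree v) / ∑ w, (G.degree w : ℝ)) := by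
    intro w
    have := Real.sqrt_pos.2 (hd w)
    field_simp
  rw [Finset.sum_congr rfl fun w _ => this w, ← Finset.sum_mul, sum_adjMatrix]
  have h := Real.sqrt_pos.2 (hd u)
  nth_rewrite 1 [← Real.mul_self_sqrt (hd u).le]
  field_simp

/-- The quadratic form of `1 - 𝓛 - P`, in terms of a function orthogonal to the constants with
respect to the degrees. -/
theorem exists_form_eq (hd : ∀ v, 0 < (G.degree v : ℝ)) (hσ : 0 < ∑ w, (G.degree w : ℝ))
    (x : V → ℝ) :
    ∃ f : V → ℝ, ∑ u, (G.degree u : ℝ) * f u = 0 ∧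
      x ⬝ᵥ ((1 - normLaplacian G - degreeProj G).mulVec x) =
        ∑ u, ∑ v, G.adjMatrix ℝ u v * (f u * f v) ∧
      ∑ u, G.degree u * f u ^ 2 ≤ x ⬝ᵥ x := by
  set σ := ∑ w, (G.degree w : ℝ) with hσdef
  have hs : ∀ v, 0 < √(G.degree v : ℝ) := fun v => Real.sqrt_pos.2 (hd v)
  have hss : ∀ v, √(G.degree v : ℝ) * √(G.degree v) = G.degree v := fun v =>
    Real.mul_self_sqrt (hd v).le
  set q := ∑ v, √(G.degree v : ℝ) * x v with hq
  let g : V → ℝ := fun v => x v / √(G.degree v)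
  have hx : ∀ v, x v = √(G.degree v) * g v := fun v => by
    have := hs v
    simp only [g]; field_simp
  have hgq : ∑ u, (G.degree u : ℝ) * g u = q := by
    refine Finset.sum_congr rfl fun u _ => ?_
    rw [hx u, ← mul_assoc, hss]
  have hA : ∑ u, ∑ v, G.adjMatrix ℝ u v * g u = q := by
    simp only [← Finset.sum_mul, sum_adjMatrix, hgq]
  have hA' : ∑ u, ∑ v, G.adjMatrix ℝ u v * g v = q := by
    rw [← hA, Finset.sum_comm]
    simp only [adjMatrix_symm G]
  have hA1 : ∑ u, ∑ v, G.adjMatrix ℝ u v = σ := by simp only [sum_adjMatrix, hσdef]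
  -- D^{-1/2}x minus its degree-weighted mean. Centring removes q²/σ, the form of P at x, from both
  -- the quadratic form and the square norm.
  refine ⟨fun v => g v - q / σ, ?_, ?_, ?_⟩
  · simp only [mul_sub, Finset.sum_sub_distrib, hgq, ← Finset.sum_mul]
    rw [← hσdef]; field_simp; ring
  · have r : ∑ u, ∑ v, G.adjMatrix ℝ u v * ((g u - q / σ) * (g v - q / σ)) =
        ∑ u, ∑ v, G.adjMatrix ℝ u v * (g u * g v) - q ^ 2 / σ := by
      have : ∑ u, ∑ v, G.adjMatrix ℝ u v * ((g u - q / σ) * (g v - q / σ)) =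
          ∑ u, ∑ v, G.adjMatrix ℝ u v * (g u * g v)
            - q / σ * ∑ u, ∑ v, G.adjMatrix ℝ u v * g u
            - q / σ * ∑ u, ∑ v, G.adjMatrix ℝ u v * g v
            + (q / σ) ^ 2 * ∑ u, ∑ v, G.adjMatrix ℝ u v := by
        simp only [Finset.mul_sum, ← Finset.sum_add_distrib, ← Finset.sum_sub_distrib]
        exact Finset.sum_congr rfl fun u _ => Finset.sum_congr rfl fun v _ => by ring
      rw [this, hA, hA', hA1]
      field_simp
      ring
    have l1 : ∑ u, ∑ v, x u * ((1 - normLaplacian G) u v * x v) =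
        ∑ u, ∑ v, G.adjMatrix ℝ u v * (g u * g v) := by
      refine Finset.sum_congr rfl fun u _ => Finset.sum_congr rfl fun v _ => ?_
      rw [one_sub_normLaplacian_apply]
      simp only [g]
      ring
    have l2 : ∑ u, ∑ v, x u * (degreeProj G u v * x v) = q ^ 2 / σ := by
      rw [sq, hq, Finset.sum_mul_sum, Finset.sum_div]
      refine Finset.sum_congr rfl fun u _ => ?_
      rw [Finset.sum_div]
      refine Finset.sum_congr rfl fun v _ => ?_
      simp only [degreeProj, Matrix.of_apply]
      ring
    rw [r, ← l1, ← l2]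
    simp only [dotProduct, Matrix.mulVec, Finset.mul_sum, ← Finset.sum_sub_distrib]
    refine Finset.sum_congr rfl fun u _ => Finset.sum_congr rfl fun v _ => ?_
    rw [Matrix.sub_apply]; ring
  · have e : ∑ u, (G.degree u : ℝ) * (g u - q / σ) ^ 2 = x ⬝ᵥ x - q ^ 2 / σ := by
      have hxx : x ⬝ᵥ x = ∑ u, (G.degree u : ℝ) * g u ^ 2 := by
        refine Finset.sum_congr rfl fun u _ => ?_
        rw [← hss u, hx u]; ring
      have : ∑ u, (G.degree u : ℝ) * (g u - q / σ) ^ 2 = ∑ u, (G.degree u : ℝ) * g u ^ 2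
          - 2 * (q / σ) * ∑ u, (G.degree u : ℝ) * g u
          + (q / σ) ^ 2 * ∑ u, (G.degree u : ℝ) := by
        simp only [Finset.mul_sum, ← Finset.sum_add_distrib, ← Finset.sum_sub_distrib]
        exact Finset.sum_congr rfl fun u _ => by ring
      rw [this, hgq, ← hσdef, ← hxx]
      field_simp
      ring
    have : 0 ≤ q ^ 2 / σ := by positivity
    rw [e]
    linarith

theorem vertexNormEnergy_le [Nontrivial V] (hd : ∀ v, 0 < (G.degree v : ℝ))
    (hσ : 0 < ∑ w, (G.degree w : ℝ)) {β : ℝ} (hβ : 0 < β)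
    (h1 : √(1 - cheegerConst G ^ 2) ≤ β) (h2 : √(1 - (1 - dualCheegerConst G) ^ 2) ≤ β) (v : V) :
    vertexNormEnergy G v ≤ G.degree v / (∑ w, (G.degree w : ℝ)) +
      β * (1 - G.degree v / (∑ w, (G.degree w : ℝ))) := by
  have hM : (1 - normLaplacian G).conjTranspose = 1 - normLaplacian G := by
    ext u v
    rw [Matrix.conjTranspose_apply, star_trivial, one_sub_normLaplacian_apply,
      one_sub_normLaplacian_apply, adjMatrix_symm, mul_comm]
  have hP : (degreeProj G).conjTranspose = degreeProj G := by
    ext u v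
    simp [degreeProj, mul_comm]
  have hN : (1 - normLaplacian G - degreeProj G).conjTranspose =
      1 - normLaplacian G - degreeProj G := by
    rw [Matrix.conjTranspose_sub, hM, hP]
  have hβ1 : (β • 1 : Matrix V V ℝ).conjTranspose = β • 1 := by simp
  have hf0 : ∀ f : V → ℝ, 0 ≤ ∑ u, (G.degree u : ℝ) * f u ^ 2 := fun f =>
    Finset.sum_nonneg fun u _ => by positivity
  rw [← degreeProj_apply_self, vertexNormEnergy, ← neg_sub, matrixAbs_neg]
  refine matrixAbs_diag_le hM hP (degreeProj_mul_self hσ)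
    (one_sub_normLaplacian_mul_degreeProj hd) hβ ?_ ?_ v
  · refine .of_dotProduct_mulVec_nonneg ?_ fun x => ?_
    · rw [Matrix.IsHermitian, Matrix.conjTranspose_sub, hN, hβ1]
    · obtain ⟨f, hf, hform, hle⟩ := exists_form_eq hd hσ x
      rw [star_trivial, Matrix.sub_mulVec, dotProduct_sub, hform, Matrix.smul_mulVec,
        Matrix.one_mulVec, dotProduct_smul, smul_eq_mul]
      have := adjMatrix_form_le G hf
      have := mul_le_mul h1 hle (hf0 f) hβ.le
      linarith
  · refine .of_dotProduct_mulVec_nonneg ?_ fun x => ?_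
    · rw [Matrix.IsHermitian, Matrix.conjTranspose_add, hN, hβ1]
    · obtain ⟨f, hf, hform, hle⟩ := exists_form_eq hd hσ x
      rw [star_trivial, Matrix.add_mulVec, dotProduct_add, hform, Matrix.smul_mulVec,
        Matrix.one_mulVec, dotProduct_smul, smul_eq_mul]
      have := neg_adjMatrix_form_le G f
      have := mul_le_mul h2 hle (hf0 f) hβ.le
      linarith

end Energy

end VertexEnergy

theorem mainTheorem9 {V : Type*} [Fintype V] [DecidableEq V] (G : SimpleGraph V)
    [DecidableRel G.Adj] (hG : G.Connected) (hn : 2 ≤ Fintype.card V)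
    (α : ℝ)
    (hα : α = max (Real.sqrt (1 - VertexEnergy.cheegerConst G ^ 2))
      (Real.sqrt (1 - (1 - VertexEnergy.dualCheegerConst G) ^ 2))) :
    (∀ v : V, VertexEnergy.vertexNormEnergy G v ≤
      (G.degree v : ℝ) / (2 * (G.edgeFinset.card : ℝ)) +
        α * (1 - (G.degree v : ℝ) / (2 * (G.edgeFinset.card : ℝ)))) ∧
    VertexEnergy.graphNormEnergy G ≤ 1 + α * ((Fintype.card V : ℝ) - 1) := by
  have : Nontrivial V := Fintype.one_lt_card_iff_nontrivial.1 hn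
  have hd : ∀ v, 0 < (G.degree v : ℝ) := fun v => by
    exact_mod_cast hG.preconnected.degree_pos_of_nontrivial v
  have hσ : 0 < ∑ w, (G.degree w : ℝ) := Finset.sum_pos (fun v _ => hd v) Finset.univ_nonempty
  have hm : ∑ w, (G.degree w : ℝ) = 2 * G.edgeFinset.card := by
    exact_mod_cast G.sum_degrees_eq_twice_card_edges
  have hα0 : 0 ≤ α := hα ▸ le_max_of_le_left (Real.sqrt_nonneg _)
  have hvertex : ∀ v : V, VertexEnergy.vertexNormEnergy G v ≤
      (G.degree v : ℝ) / (2 * (G.edgeFinset.card : ℝ)) +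
        α * (1 - (G.degree v : ℝ) / (2 * (G.edgeFinset.card : ℝ))) := by
    intro v
    -- `vertexNormEnergy_le` divides by β and needs β > 0, while only α ≥ 0 is at hand; hence β = α
    -- + ε.
    refine le_of_forall_pos_le_add fun ε hε => ?_
    have h1 := VertexEnergy.vertexNormEnergy_le hd hσ (β := α + ε) (by linarith)
      (((le_max_left _ _).trans hα.ge).trans (by linarith))
      (((le_max_right _ _).trans hα.ge).trans (by linarith)) v
    rw [hm] at h1
    have h2 : 0 ≤ (G.degree v : ℝ) / (2 * (G.edgeFinset.card : ℝ)) := by positivity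
    have h3 := mul_nonneg hε.le h2
    linarith
  refine ⟨hvertex, ?_⟩
  have hone : ∑ v, (G.degree v : ℝ) / (2 * (G.edgeFinset.card : ℝ)) = 1 := by
    rw [← Finset.sum_div, ← hm, div_self hσ.ne']
  calc VertexEnergy.graphNormEnergy G = ∑ v, VertexEnergy.vertexNormEnergy G v := rfl
    _ ≤ _ := Finset.sum_le_sum fun v _ => hvertex v
    _ = 1 + α * ((Fintype.card V : ℝ) - 1) := by
      rw [Finset.sum_add_distrib, ← Finset.mul_sum, Finset.sum_sub_distrib, hone]
      simp
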